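/- Let $G$ be a finite connected metric graph with $n$ nodes and positive edge lengths, with shortest path metric $d_G$. Let $e$ be an edge of length $L$, with arc-length parameterization $\mathbf{p}:[0,L]\to e$. For $s\in[0,L]$ let $\mathrm{Dg}_s$ denote the $0$-th persistence diagram (finite, off-diagonal points) of the super-level set filtration of the function $x\mapsto d_G(\mathbf{p}(s),x)$ on $G$: a pair $(\beta,\delta)$ with $\delta<\beta$ belongs to $\mathrm{Dg}_s$ if a connected component is created at level $\beta$ and merges at level $\delta$ with another component that was created no later. Let $I\subseteq[0,L]$ be an interval (for instance $I=[0,L]$), and let $b,d:I\to\mathbb{R}$ be continuous functions with $(b(s),d(s))\in \mathrm{Dg}_s$ for all $s\in I$; that is, $(b(s),d(s))$ tracks a persistence point as the basepoint $\mathbf{p}(s)$ moves along $e$. Then either $d\equiv 0$ on $I$ (the case in which the component dies at the basepoint itself), or the death-time function $d$ is continuous and piecewise linear on $I$ with at most $C\,n$ pieces, each of slope $1$ or $-1$, where $C$ is a universal constant. In both cases $d$ is $1$-Lipschitz on $I$. -/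

import Mathlib

open Set

/-- A connected graph with node set `V`, edge set `E` and positive edge lengths. Every edge carries
an orientation, which only serves to choose the arc-length parameterization of the edge. Loops and
parallel edges are allowed; every connected simple graph is a special case. -/
structure MetricGraph (V E : Type*) where
  src : E → V
  tgt : E → V
  length : E → ℝ
  length_pos : ∀ e, 0 < length e
  connected : ∀ u v : V, Relation.EqvGen (fun a b => ∃ e, src e = a ∧ tgt e = b) u v

namespace MetricGraph

variable {V E : Type*}

/-- The points of the geometric realization: the nodes, and for every edge `e` its interior points,
given by their arc-length parameter `t` with `0 < t < length e`. -/
inductive Point (G : MetricGraph V E) : Type _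
  | node (v : V) : Point G
  | inner (e : E) (t : ℝ) (h₀ : 0 < t) (h₁ : t < G.length e) : Point G

/-- The arc-length parameterization `[0, length e] → |e|` of the edge `e`
(extended by constants outside of `[0, length e]`). -/
noncomputable def edgePoint (G : MetricGraph V E) (e : E) (t : ℝ) : G.Point :=
  if h₀ : t ≤ 0 then .node (G.src e)
  else if h₁ : G.length e ≤ t then .node (G.tgt e)
  else .inner e t (not_le.1 h₀) (not_le.1 h₁)

/-- `G.HasPath x y l`: there is a path of length `l` from `x` to `y`, that is, a finite
concatenation of segments, each contained in one (closed) edge, with total length `l`. -/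
inductive HasPath (G : MetricGraph V E) : G.Point → G.Point → ℝ → Prop
  | refl (x : G.Point) : HasPath G x x 0
  | step (e : E) (s t : ℝ) (hs : s ∈ Icc 0 (G.length e)) (ht : t ∈ Icc 0 (G.length e))
      (y : G.Point) (l : ℝ) (h : HasPath G (G.edgePoint e t) y l) :
      HasPath G (G.edgePoint e s) y (|s - t| + l)

/-- The shortest path distance of the metric graph. -/
noncomputable def pathDist (G : MetricGraph V E) (x y : G.Point) : ℝ :=
  sInf {l | G.HasPath x y l}

theorem edgePoint_zero (G : MetricGraph V E) (e : E) :
    G.edgePoint e 0 = .node (G.src e) := by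
  simp [edgePoint]

theorem edgePoint_length (G : MetricGraph V E) (e : E) :
    G.edgePoint e (G.length e) = .node (G.tgt e) := by
  simp [edgePoint, not_le.2 (G.length_pos e)]

theorem edgePoint_inner (G : MetricGraph V E) (e : E) (t : ℝ) (h₀ : 0 < t) (h₁ : t < G.length e) :
    G.edgePoint e t = .inner e t h₀ h₁ := by
  simp [edgePoint, not_le.2 h₀, not_le.2 h₁]

theorem HasPath.nonneg {G : MetricGraph V E} {x y : G.Point} {l : ℝ} (h : G.HasPath x y l) :
    0 ≤ l := by
  induction h with
  | refl x => exact le_rfl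
  | step e s t hs ht y l h ih => positivity

theorem HasPath.trans {G : MetricGraph V E} {x y z : G.Point} {l l' : ℝ} (h : G.HasPath x y l)
    (h' : G.HasPath y z l') : G.HasPath x z (l + l') := by
  induction h with
  | refl x => simpa using h'
  | step e s t hs ht y l h ih =>
    rw [add_assoc]
    exact .step e s t hs ht _ _ (ih h')

theorem HasPath.single {G : MetricGraph V E} (e : E) {s t : ℝ} (hs : s ∈ Icc 0 (G.length e))
    (ht : t ∈ Icc 0 (G.length e)) : G.HasPath (G.edgePoint e s) (G.edgePoint e t) |s - t| := by
  simpa using HasPath.step e s t hs ht _ 0 (.refl _)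

theorem HasPath.symm {G : MetricGraph V E} {x y : G.Point} {l : ℝ} (h : G.HasPath x y l) :
    G.HasPath y x l := by
  induction h with
  | refl x => exact .refl x
  | step e s t hs ht y l h ih =>
    rw [add_comm, abs_sub_comm]
    exact ih.trans (HasPath.single e ht hs)

theorem exists_hasPath (G : MetricGraph V E) (x y : G.Point) : ∃ l, G.HasPath x y l := by
  have key : ∀ u v : V, ∃ l, G.HasPath (.node u) (.node v) l := by
    intro u v
    induction G.connected u v with
    | rel a b h =>
      obtain ⟨e, rfl, rfl⟩ := h
      refine ⟨|0 - G.length e|, ?_⟩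
      rw [← G.edgePoint_zero, ← G.edgePoint_length]
      exact HasPath.single e (left_mem_Icc.2 (G.length_pos e).le)
        (right_mem_Icc.2 (G.length_pos e).le)
    | refl a => exact ⟨0, .refl _⟩
    | symm a b _ ih => exact ih.imp fun _ h => h.symm
    | trans a b c _ _ ih ih' =>
      obtain ⟨l, h⟩ := ih
      obtain ⟨l', h'⟩ := ih'
      exact ⟨_, h.trans h'⟩
  have key' : ∀ x : G.Point, ∃ v l, G.HasPath x (.node v) l := by
    rintro (v | ⟨e, t, h₀, h₁⟩)
    · exact ⟨v, 0, .refl _⟩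
    · refine ⟨G.src e, |t - 0|, ?_⟩
      rw [← G.edgePoint_inner e t h₀ h₁, ← G.edgePoint_zero]
      exact HasPath.single e ⟨h₀.le, h₁.le⟩ (left_mem_Icc.2 (G.length_pos e).le)
  obtain ⟨u, l, h⟩ := key' x
  obtain ⟨v, l', h'⟩ := key' y
  obtain ⟨l'', h''⟩ := key u v
  exact ⟨_, (h.trans h'').trans h'.symm⟩

theorem bddBelow_hasPath (G : MetricGraph V E) (x y : G.Point) :
    BddBelow {l | G.HasPath x y l} :=
  ⟨0, fun _ h => h.nonneg⟩

theorem HasPath.abs_sub_le {G : MetricGraph V E} {x y : G.Point} {l : ℝ} (h : G.HasPath x y l)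
    (φ : G.Point → ℝ) (hφ : ∀ e, ∀ s ∈ Icc 0 (G.length e), ∀ t ∈ Icc 0 (G.length e),
      |φ (G.edgePoint e s) - φ (G.edgePoint e t)| ≤ |s - t|) : |φ x - φ y| ≤ l := by
  induction h with
  | refl x => simp
  | step e s t hs ht y l h ih =>
    exact (_root_.abs_sub_le _ (φ (G.edgePoint e t)) _).trans (add_le_add (hφ e s hs t ht) ih)

theorem eq_of_pathDist_eq_zero_of_lipschitz (G : MetricGraph V E) {x y : G.Point}
    (h : G.pathDist x y = 0)
    (φ : G.Point → ℝ) (hφ : ∀ e, ∀ s ∈ Icc 0 (G.length e), ∀ t ∈ Icc 0 (G.length e),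
      |φ (G.edgePoint e s) - φ (G.edgePoint e t)| ≤ |s - t|) : φ x = φ y := by
  have : |φ x - φ y| ≤ G.pathDist x y :=
    le_csInf (G.exists_hasPath x y) fun l hl => HasPath.abs_sub_le hl φ hφ
  rw [h] at this
  exact sub_eq_zero.1 (abs_nonpos_iff.1 this)

theorem pathDist_comm (G : MetricGraph V E) (x y : G.Point) : G.pathDist x y = G.pathDist y x :=
  congrArg sInf (Set.ext fun _ => ⟨HasPath.symm, HasPath.symm⟩)

open Classical in
theorem eq_inner_of_pathDist_eq_zero (G : MetricGraph V E) (e₀ : E) (t₀ : ℝ) (h₀ : 0 < t₀)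
    (h₁ : t₀ < G.length e₀) (y : G.Point) (h : G.pathDist (.inner e₀ t₀ h₀ h₁) y = 0) :
    Point.inner e₀ t₀ h₀ h₁ = y := by
  set r := min t₀ (G.length e₀ - t₀) with hr
  have hr0 : 0 < r := lt_min h₀ (by linarith)
  have hr1 : r ≤ t₀ := min_le_left _ _
  have hr2 : r ≤ G.length e₀ - t₀ := min_le_right _ _
  let φ : G.Point → ℝ := fun z => match z with
    | .node _ => 0
    | .inner e t _ _ => if e = e₀ then max 0 (r - |t - t₀|) else 0
  have hφ : ∀ e, ∀ t ∈ Icc 0 (G.length e),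
      φ (G.edgePoint e t) = if e = e₀ then max 0 (r - |t - t₀|) else 0 := by
    rintro e t ⟨ht0, ht1⟩
    rcases ht0.eq_or_lt with rfl | ht0
    · rw [edgePoint_zero]
      split_ifs with he
      · rw [max_eq_left]
        rw [zero_sub, abs_neg, abs_of_pos h₀]; linarith
      · rfl
    rcases ht1.eq_or_lt with rfl | ht1
    · rw [edgePoint_length]
      split_ifs with he
      · subst he
        rw [max_eq_left]
        rw [abs_of_pos (by linarith)]; linarith
      · rfl
    rw [edgePoint_inner G e t ht0 ht1]
  have hlip := G.eq_of_pathDist_eq_zero_of_lipschitz h φ (by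
    intro e s hs t ht
    rw [hφ e s hs, hφ e t ht]
    split_ifs
    · refine (abs_max_sub_max_le_max _ _ _ _).trans ?_
      simp only [sub_self, abs_zero]
      refine max_le (abs_nonneg _) ?_
      have := abs_abs_sub_abs_le (t - t₀) (s - t₀)
      rw [show r - |s - t₀| - (r - |t - t₀|) = |t - t₀| - |s - t₀| by ring, abs_sub_comm s t]
      simpa using this
    · simp)
  have hx : φ (.inner e₀ t₀ h₀ h₁) = r := by simp [φ, hr0.le]
  rw [hx] at hlip
  match y with
  | .node v => exact absurd hlip hr0.ne'
  | .inner e t _ _ =>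
    simp only [φ] at hlip
    split_ifs at hlip with he
    · subst he
      have : |t - t₀| ≤ 0 := by
        rcases max_choice 0 (r - |t - t₀|) with h | h <;> rw [h] at hlip <;> linarith
      have : t = t₀ := sub_eq_zero.1 (abs_nonpos_iff.1 this)
      subst this
      rfl
    · exact absurd hlip hr0.ne'

open Classical in
theorem eq_of_pathDist_eq_zero [Finite E] (G : MetricGraph V E) (x y : G.Point)
    (h : G.pathDist x y = 0) : x = y := by
  match x, y with
  | .inner e t h₀ h₁, y => exact G.eq_inner_of_pathDist_eq_zero e t h₀ h₁ y h
  | .node v, .inner e t h₀ h₁ =>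
    exact (G.eq_inner_of_pathDist_eq_zero e t h₀ h₁ _ (by rwa [pathDist_comm])).symm
  | .node v, .node w =>
    obtain ⟨r, hr0, hr⟩ : ∃ r : ℝ, 0 < r ∧ ∀ e, r ≤ G.length e := by
      rcases isEmpty_or_nonempty E with hE | hE
      · exact ⟨1, one_pos, fun e => (hE.false e).elim⟩
      · obtain ⟨e, he⟩ := Finite.exists_min G.length
        exact ⟨_, G.length_pos e, he⟩
    let ψ : V → ℝ := fun u => if u = v then r else 0
    have hψ : ∀ a b, |ψ a - ψ b| ≤ r := by
      intro a b
      simp only [ψ]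
      split_ifs <;> simp [hr0.le, abs_of_pos hr0]
    let φ : G.Point → ℝ := fun z => match z with
      | .node u => ψ u
      | .inner e t _ _ => ψ (G.src e) + t * ((ψ (G.tgt e) - ψ (G.src e)) / G.length e)
    have hφ : ∀ e, ∀ t ∈ Icc 0 (G.length e), φ (G.edgePoint e t) =
        ψ (G.src e) + t * ((ψ (G.tgt e) - ψ (G.src e)) / G.length e) := by
      rintro e t ⟨ht0, ht1⟩
      have hl := (G.length_pos e).ne'
      rcases ht0.eq_or_lt with rfl | ht0
      · rw [edgePoint_zero]; simp [φ]
      rcases ht1.eq_or_lt with rfl | ht1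
      · rw [edgePoint_length]
        simp only [φ]
        field_simp
        ring
      rw [edgePoint_inner G e t ht0 ht1]
    have hlip := G.eq_of_pathDist_eq_zero_of_lipschitz h φ (by
      intro e s hs t ht
      rw [hφ e s hs, hφ e t ht]
      rw [add_sub_add_left_eq_sub, ← sub_mul, abs_mul, abs_div, abs_of_pos (G.length_pos e)]
      refine mul_le_of_le_one_right (abs_nonneg _) ?_
      rw [div_le_one (G.length_pos e)]
      exact (hψ _ _).trans (hr e))
    simp only [φ, ψ, if_true] at hlip
    split_ifs at hlip with hw
    · rw [hw]
    · exact absurd hlip hr0.ne'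

/-- A finite metric graph is a metric space under the shortest path distance. -/
noncomputable instance [Finite E] (G : MetricGraph V E) : MetricSpace G.Point where
  dist := G.pathDist
  dist_self x := le_antisymm (csInf_le (G.bddBelow_hasPath x x) (.refl x))
    (Real.sInf_nonneg fun _ h => h.nonneg)
  dist_comm := G.pathDist_comm
  dist_triangle x y z := by
    refine le_of_forall_pos_lt_add fun ε hε => ?_
    obtain ⟨l, hl, hl'⟩ := exists_lt_of_csInf_lt (G.exists_hasPath x y)
      (lt_add_of_pos_right (G.pathDist x y) (half_pos hε))
    obtain ⟨k, hk, hk'⟩ := exists_lt_of_csInf_lt (G.exists_hasPath y z)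
      (lt_add_of_pos_right (G.pathDist y z) (half_pos hε))
    have : G.pathDist x z ≤ l + k := csInf_le (G.bddBelow_hasPath x z) (HasPath.trans hl hk)
    linarith
  eq_of_dist_eq_zero {x y} h := G.eq_of_pathDist_eq_zero x y h

end MetricGraph

/-- `(b, d)` is an (off-diagonal, finite) point of the 0-th persistence diagram of the super-level
set filtration `X^α = {z | α ≤ f z}` of `f`, where `α` decreases. There is a connected component,
represented by a point `x` with `f x = b`, which is created at time `b` (down to every level
`α > d`, the component of `x` in `X^α` does not reach above `b`) and which at time `d`, and not
earlier, merges with another component, represented by `y`, that has been created no later. -/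
def IsPersistencePoint {X : Type*} [TopologicalSpace X] (f : X → ℝ) (b d : ℝ) : Prop :=
  d < b ∧ ∃ x y : X, f x = b ∧ b ≤ f y ∧
    y ∈ connectedComponentIn {z | d ≤ f z} x ∧
    ∀ α, d < α → y ∉ connectedComponentIn {z | α ≤ f z} x ∧
      ∀ z ∈ connectedComponentIn {z | α ≤ f z} x, f z ≤ b

/-- `(b, d)` tracks a persistence point while the basepoint `G.edgePoint e s` moves along the
edge `e`, for the parameters `s ∈ I`: it moves continuously and is, for every `s ∈ I`, a point of
the 0-th persistence diagram of the distance function to the basepoint. -/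
def MetricGraph.IsTracking {V E : Type*} [Finite E] (G : MetricGraph V E) (e : E) (I : Set ℝ)
    (b d : ℝ → ℝ) : Prop :=
  ContinuousOn b I ∧ ContinuousOn d I ∧
    ∀ s ∈ I, IsPersistencePoint (fun x : G.Point => dist (G.edgePoint e s) x) (b s) (d s)

/-- On `I`, the function `g` is continuous and piecewise linear with at most `N` pieces, all of them
of slope `1` or `-1`. -/
def IsPiecewiseUnitSlope (g : ℝ → ℝ) (I : Set ℝ) (N : ℕ) : Prop :=
  ∃ k ≤ N, ∃ t : ℕ → ℝ, Monotone t ∧ I ⊆ Icc (t 0) (t k) ∧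
    ∀ i < k, ∃ σ c : ℝ, (σ = 1 ∨ σ = -1) ∧ ∀ s ∈ I ∩ Icc (t i) (t (i + 1)), g s = σ * s + c

open Filter Topology

namespace MetricGraph

/-! The main point is that a component can die only at level `0` or at a level that is the distance
from the basepoint to some node. Away from the basepoint, inside an edge, the distance is locally
`min (a + τ) (b - τ)`, so it has no local minimum there. At a positive level attained at no node,
passing to slightly higher levels therefore separates nothing, and no merge can happen exactly at
that level (`dist_local_structure`, `JoinedAbove.of_mem_connectedComponentIn`).

As the basepoint moves along `e`, the distance to a node is the minimum of a function of slope `1`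
and one of slope `-1`, and it is at least the distance along `e` to the nearer end. The latter keeps
a continuous death time from passing between `0` and node distances in the interior of `e`. In the
remaining case the death time is a continuous selection from finitely many 1-Lipschitz functions,
hence 1-Lipschitz. It then agrees with each line of slope `±1` on an interval, and the ends of these
intervals, two lines per node with two ends each, are the breakpoints. -/

theorem edgePoint_eq_edgePoint {V E : Type*} {G : MetricGraph V E} {e e' : E} {s t : ℝ}
    (hs : s ∈ Ioo 0 (G.length e))
    (ht : t ∈ Icc 0 (G.length e')) (h : G.edgePoint e s = G.edgePoint e' t) : e = e' ∧ s = t := by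
  rw [edgePoint_inner G e s hs.1 hs.2] at h
  rcases ht.1.eq_or_lt with rfl | h₀
  · simp [edgePoint_zero] at h
  rcases ht.2.eq_or_lt with rfl | h₁
  · simp [edgePoint_length] at h
  rw [edgePoint_inner G e' t h₀ h₁] at h
  simpa using h

/-! ### Distances and paths along an edge -/

section Distance

variable {V E : Type*} [Finite E] {G : MetricGraph V E}

theorem HasPath.dist_le {x y : G.Point} {l : ℝ} (h : G.HasPath x y l) : dist x y ≤ l :=
  csInf_le (G.bddBelow_hasPath x y) h

theorem le_dist_of_forall_hasPath {x y : G.Point} {r : ℝ} (h : ∀ l, G.HasPath x y l → r ≤ l) :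
    r ≤ dist x y :=
  le_csInf (G.exists_hasPath x y) h

theorem exists_hasPath_of_dist_lt {x y : G.Point} {r : ℝ} (h : dist x y < r) :
    ∃ l < r, G.HasPath x y l := by
  obtain ⟨l, hl, hlr⟩ := exists_lt_of_csInf_lt (G.exists_hasPath x y) h
  exact ⟨l, hlr, hl⟩

theorem dist_edgePoint_le (e : E) {s t : ℝ} (hs : s ∈ Icc 0 (G.length e))
    (ht : t ∈ Icc 0 (G.length e)) : dist (G.edgePoint e s) (G.edgePoint e t) ≤ |s - t| :=
  (HasPath.single e hs ht).dist_le

theorem continuousOn_edgePoint (e : E) : ContinuousOn (G.edgePoint e) (Icc 0 (G.length e)) := by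
  have : LipschitzOnWith 1 (G.edgePoint e) (Icc 0 (G.length e)) :=
    LipschitzOnWith.of_dist_le_mul fun s hs t ht => by
      simpa [Real.dist_eq] using dist_edgePoint_le e hs ht
  exact this.continuousOn

/-- The distance to a point outside of an open segment, from a point of the segment, is attained
through one of the two ends of the segment. -/
theorem dist_edgePoint_eq_min (e : E) {u t w : ℝ} (hu : 0 ≤ u) (hw : w ≤ G.length e)
    (ht : t ∈ Icc u w) (p : G.Point) (hp : ∀ τ ∈ Ioo u w, G.edgePoint e τ ≠ p) :
    dist (G.edgePoint e t) p =
      min (dist (G.edgePoint e u) p + (t - u)) (dist (G.edgePoint e w) p + (w - t)) := by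
  obtain ⟨hut, htw⟩ := ht
  have hU : u ∈ Icc 0 (G.length e) := ⟨hu, by linarith⟩
  have hW : w ∈ Icc 0 (G.length e) := ⟨by linarith, hw⟩
  have hT : t ∈ Icc 0 (G.length e) := ⟨by linarith, by linarith⟩
  apply le_antisymm
  · apply le_min
    · have h₁ := dist_triangle (G.edgePoint e t) (G.edgePoint e u) p
      have h₂ := dist_edgePoint_le e hT hU
      rw [abs_of_nonneg (by linarith)] at h₂
      linarith
    · have h₁ := dist_triangle (G.edgePoint e t) (G.edgePoint e w) p
      have h₂ := dist_edgePoint_le e hT hW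
      rw [abs_of_nonpos (by linarith)] at h₂
      linarith
  · rcases hut.eq_or_lt with rfl | hut
    · exact (min_le_left _ _).trans (by linarith)
    rcases htw.eq_or_lt with rfl | htw
    · exact (min_le_right _ _).trans (by linarith)
    -- Quantifying over the starting parameter lets the induction continue when the first segment of
    -- the path ends inside `(u, w)` again; otherwise that segment passes `u` or `w`.
    have key : ∀ (x y : G.Point) (l : ℝ), G.HasPath x y l →
        (∀ τ ∈ Ioo u w, G.edgePoint e τ ≠ y) → ∀ τ ∈ Ioo u w, x = G.edgePoint e τ →
        min (dist (G.edgePoint e u) y + (τ - u)) (dist (G.edgePoint e w) y + (w - τ)) ≤ l := by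
      intro x y l h
      induction h with
      | refl x => intro hy τ hτ hx; exact absurd hx.symm (hy τ hτ)
      | step e' s t' hs ht' y l h ih =>
        intro hy τ hτ hx
        obtain ⟨rfl, rfl⟩ := edgePoint_eq_edgePoint
          ⟨by linarith [hτ.1], by linarith [hτ.2]⟩ hs hx.symm
        have a₁ := le_abs_self (τ - t')
        have a₂ := neg_abs_le (τ - t')
        rcases le_or_gt t' u with h₁ | h₁
        · have b₁ := dist_triangle (G.edgePoint e u) (G.edgePoint e t') y
          have b₂ := dist_edgePoint_le e hU ht'
          have b₃ := h.dist_le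
          rw [abs_of_nonneg (by linarith)] at b₂
          exact (min_le_left _ _).trans (by linarith)
        rcases le_or_gt w t' with h₂ | h₂
        · have b₁ := dist_triangle (G.edgePoint e w) (G.edgePoint e t') y
          have b₂ := dist_edgePoint_le e hW ht'
          have b₃ := h.dist_le
          rw [abs_of_nonpos (by linarith)] at b₂
          exact (min_le_right _ _).trans (by linarith)
        · rcases min_le_iff.1 (ih hy t' ⟨h₁, h₂⟩ rfl) with h₃ | h₃
          · exact (min_le_left _ _).trans (by linarith)
          · exact (min_le_right _ _).trans (by linarith)
    exact le_dist_of_forall_hasPath fun l hl => key _ _ l hl hp t ⟨hut, htw⟩ rfl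

/-- A point off the open segment is reached from the centre only through one of its ends, which
costs at least `r`. -/
theorem ball_edgePoint_subset (e : E) {t r : ℝ} (h₀ : 0 ≤ t - r) (h₁ : t + r ≤ G.length e) :
    Metric.ball (G.edgePoint e t) r ⊆ G.edgePoint e '' Ioo (t - r) (t + r) := by
  intro x hx
  by_contra hxn
  have hr : 0 < r := Metric.pos_of_mem_ball hx
  have h := dist_edgePoint_eq_min e h₀ h₁ (t := t) ⟨by linarith, by linarith⟩ x
    fun τ hτ hτx => hxn ⟨τ, hτ, hτx⟩
  rw [Metric.mem_ball', h, min_lt_iff] at hx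
  have d₁ := dist_nonneg (x := G.edgePoint e (t - r)) (y := x)
  have d₂ := dist_nonneg (x := G.edgePoint e (t + r)) (y := x)
  rcases hx with hx | hx <;> linarith

/-- The trace of the path is such a set; the bound on distances later keeps it inside a super-level
set. -/
theorem HasPath.exists_isPreconnected {x y : G.Point} {l : ℝ} (h : G.HasPath x y l) :
    ∃ K : Set G.Point, IsPreconnected K ∧ x ∈ K ∧ y ∈ K ∧ ∀ z ∈ K, dist x z ≤ l := by
  induction h with
  | refl x => exact ⟨{x}, isPreconnected_singleton, rfl, rfl, by simp⟩
  | step e s t hs ht y l h ih =>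
    obtain ⟨K, hK, htK, hyK, hKl⟩ := ih
    have hsub : uIcc s t ⊆ Icc 0 (G.length e) := ordConnected_Icc.uIcc_subset hs ht
    refine ⟨G.edgePoint e '' uIcc s t ∪ K, ?_, .inl (mem_image_of_mem _ left_mem_uIcc),
      .inr hyK, ?_⟩
    · exact (isPreconnected_uIcc.image _ ((continuousOn_edgePoint e).mono hsub)).union
        (G.edgePoint e t) (mem_image_of_mem _ right_mem_uIcc) htK hK
    · have hl := h.nonneg
      rintro z (⟨τ, hτ, rfl⟩ | hz)
      · refine (dist_edgePoint_le e hs (hsub hτ)).trans ?_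
        have := abs_sub_left_of_mem_uIcc hτ
        rw [abs_sub_comm s τ, abs_sub_comm s t]
        linarith
      · have := dist_triangle (G.edgePoint e s) (G.edgePoint e t) z
        have := dist_edgePoint_le e hs ht
        linarith [hKl z hz]

end Distance

end MetricGraph

/-! ### Connectedness at a level and just above it -/

/-- The points `x` and `y` lie in a connected set on which `f` stays above a level `α > c`. -/
def JoinedAbove {X : Type*} [TopologicalSpace X] (f : X → ℝ) (c : ℝ) (x y : X) : Prop :=
  ∃ α, c < α ∧ ∃ K : Set X, IsPreconnected K ∧ x ∈ K ∧ y ∈ K ∧ ∀ z ∈ K, α ≤ f z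

namespace JoinedAbove

variable {X : Type*} [TopologicalSpace X] {f : X → ℝ} {c : ℝ} {x y z : X}

theorem refl (h : c < f x) : JoinedAbove f c x x :=
  ⟨f x, h, {x}, isPreconnected_singleton, rfl, rfl, by simp⟩

theorem symm (h : JoinedAbove f c x y) : JoinedAbove f c y x := by
  obtain ⟨α, hα, K, hK, hx, hy, hf⟩ := h
  exact ⟨α, hα, K, hK, hy, hx, hf⟩

theorem trans (h : JoinedAbove f c x y) (h' : JoinedAbove f c y z) : JoinedAbove f c x z := by
  obtain ⟨α, hα, K, hK, hx, hy, hf⟩ := h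
  obtain ⟨α', hα', K', hK', hx', hy', hf'⟩ := h'
  refine ⟨min α α', lt_min hα hα', K ∪ K', hK.union y hy hx' hK', .inl hx, .inr hy', ?_⟩
  rintro w (hw | hw)
  · exact (min_le_left _ _).trans (hf w hw)
  · exact (min_le_right _ _).trans (hf' w hw)

theorem exists_mem_connectedComponentIn (h : JoinedAbove f c x y) :
    ∃ α, c < α ∧ y ∈ connectedComponentIn {z | α ≤ f z} x := by
  obtain ⟨α, hα, K, hK, hx, hy, hf⟩ := h
  exact ⟨α, hα, hK.subset_connectedComponentIn hx hf hy⟩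

/-- If every point at level at least `c` is either isolated among these points, or has a
neighborhood that contains points above `c` and all of them are joined above `c`, then passing from
the level `c` to slightly higher levels does not disconnect points. -/
theorem of_mem_connectedComponentIn [T1Space X]
    (hloc : ∀ z, c ≤ f z → (∀ᶠ w in 𝓝 z, c ≤ f w → w = z) ∨
      ((∃ᶠ w in 𝓝 z, c < f w) ∧
        ∃ N ∈ 𝓝 z, ∀ w ∈ N, ∀ w' ∈ N, c < f w → c < f w' → JoinedAbove f c w w'))
    (hx : c < f x) (hy : c < f y) (h : y ∈ connectedComponentIn {z | c ≤ f z} x) :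
    JoinedAbove f c x y := by
  by_contra hxy
  set C := connectedComponentIn {z | c ≤ f z} x with hC
  have hxC : x ∈ C := mem_connectedComponentIn hx.le
  have hCpre : IsPreconnected C := isPreconnected_connectedComponentIn
  have hCsub : ∀ z ∈ C, c ≤ f z := fun z hz =>
    connectedComponentIn_subset {z | c ≤ f z} x hz
  have hloc' : ∀ z ∈ C, (∃ᶠ w in 𝓝 z, c < f w) ∧
      ∃ N ∈ 𝓝 z, ∀ w ∈ N, ∀ w' ∈ N, c < f w → c < f w' → JoinedAbove f c w w' := by
    intro z hz
    refine (hloc z (hCsub z hz)).resolve_left fun hiso => ?_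
    -- A point isolated in the super-level set is an entire component, which would force `x = y`.
    obtain ⟨N, hN, hNo, hzN⟩ := eventually_nhds_iff.1 hiso
    have hCN : C ⊆ {z} := by
      intro u hu
      by_contra huz
      obtain ⟨v, hv, hvN, hvz⟩ := hCpre _ {z}ᶜ hNo isOpen_compl_singleton
        (fun v _ => (em (v = z)).imp (fun hvz => by rwa [hvz]) id) ⟨z, hz, hzN⟩ ⟨u, hu, huz⟩
      exact hvz (hN v hvN (hCsub v hv))
    have h₁ := hCN hxC
    have h₂ := hCN h
    simp only [mem_singleton_iff] at h₁ h₂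
    exact hxy (h₁.trans h₂.symm ▸ refl hx)
  -- Separate `C` by two open sets: near a point of the first, everything above `c` is joined to
  -- `x`; near a point of the second, nothing is. They cannot meet in `C`, since points above `c`
  -- accumulate at every point of `C`.
  have hne := hCpre {z | ∀ᶠ w in 𝓝 z, c < f w → JoinedAbove f c x w}
    {z | ∀ᶠ w in 𝓝 z, c < f w → ¬ JoinedAbove f c x w} isOpen_setOfPred_eventually_nhds
    isOpen_setOfPred_eventually_nhds ?_ ⟨x, hxC, ?_⟩ ⟨y, h, ?_⟩
  · obtain ⟨z, hz, h₁, h₂⟩ := hne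
    obtain ⟨w, hw, h₁, h₂⟩ := ((hloc' z hz).1.and_eventually (h₁.and h₂)).exists
    exact h₂ hw (h₁ hw)
  · intro z hz
    obtain ⟨-, N, hN, hNJ⟩ := hloc' z hz
    by_cases hQ : ∃ w ∈ N, c < f w ∧ JoinedAbove f c x w
    · obtain ⟨w, hwN, hw, hxw⟩ := hQ
      exact .inl (mem_of_superset hN fun w' hw' hfw' => hxw.trans (hNJ w hwN w' hw' hw hfw'))
    · push Not at hQ
      exact .inr (mem_of_superset hN fun w' hw' hfw' => hQ w' hw' hfw')
  · obtain ⟨-, N, hN, hNJ⟩ := hloc' x hxC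
    exact mem_of_superset hN fun w hw hfw => hNJ x (mem_of_mem_nhds hN) w hw hx hfw
  · obtain ⟨-, N, hN, hNJ⟩ := hloc' y h
    exact mem_of_superset hN fun w hw hfw hxw =>
      hxy (hxw.trans (hNJ w hw y (mem_of_mem_nhds hN) hfw hy))

end JoinedAbove

/-! ### Local structure of the distance function and death levels -/

namespace MetricGraph

variable {V E : Type*} [Finite E] {G : MetricGraph V E}

theorem eventually_joinedAbove_dist (p : G.Point) {c : ℝ} {z : G.Point} (hz : c < dist p z) :
    ∃ N ∈ 𝓝 z, ∀ w ∈ N, JoinedAbove (fun x => dist p x) c z w := by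
  refine ⟨Metric.ball z ((dist p z - c) / 2), Metric.ball_mem_nhds _ (by linarith), ?_⟩
  intro w hw
  obtain ⟨l, hl, hpath⟩ := exists_hasPath_of_dist_lt (Metric.mem_ball'.1 hw)
  obtain ⟨K, hK, hzK, hwK, hKl⟩ := hpath.exists_isPreconnected
  refine ⟨dist p z - (dist p z - c) / 2, by linarith, K, hK, hzK, hwK, fun k hk => ?_⟩
  have h₁ := hKl k hk
  have h₂ := dist_triangle p k z
  rw [dist_comm k z] at h₂
  linarith

/-- Around an interior point of an edge other than `p`, the distance to `p` is the minimum of a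
function of slope `1` and a function of slope `-1`. -/
theorem exists_dist_edgePoint_eq_min_nhds (p : G.Point) (e : E) {t : ℝ}
    (ht : t ∈ Ioo 0 (G.length e)) (hp : p ≠ G.edgePoint e t) :
    ∃ r > 0, Icc (t - r) (t + r) ⊆ Icc 0 (G.length e) ∧ ∃ a b : ℝ,
      ∀ τ ∈ Icc (t - r) (t + r), dist p (G.edgePoint e τ) = min (a + τ) (b - τ) := by
  -- With this radius the segment stays in the edge and its interior avoids `p`.
  set r := min (min t (G.length e - t)) (dist p (G.edgePoint e t)) with hr
  have hr₀ : 0 < r := lt_min (lt_min ht.1 (by linarith [ht.2])) (dist_pos.2 hp)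
  have hr₁ : r ≤ t := (min_le_left _ _).trans (min_le_left _ _)
  have hr₂ : r ≤ G.length e - t := (min_le_left _ _).trans (min_le_right _ _)
  have hr₃ : r ≤ dist p (G.edgePoint e t) := min_le_right _ _
  have hsub : Icc (t - r) (t + r) ⊆ Icc 0 (G.length e) := Icc_subset_Icc (by linarith) (by linarith)
  refine ⟨r, hr₀, hsub, dist (G.edgePoint e (t - r)) p - (t - r),
    dist (G.edgePoint e (t + r)) p + (t + r), fun τ hτ => ?_⟩
  rw [dist_comm, dist_edgePoint_eq_min e (by linarith) (by linarith) hτ p]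
  · congr 1 <;> ring
  · rintro σ hσ rfl
    have h₁ := dist_edgePoint_le e (hsub (Ioo_subset_Icc_self hσ)) ⟨ht.1.le, ht.2.le⟩
    have h₂ : |σ - t| < r := abs_sub_lt_iff.2 ⟨by linarith [hσ.2], by linarith [hσ.1]⟩
    linarith

/-- The function `min (a + τ) (b - τ)` is concave, so between two parameters it stays above the
smaller of the two end values. -/
theorem joinedAbove_dist_edgePoint {p : G.Point} {e : E} {u v a b c : ℝ}
    (hsub : Icc u v ⊆ Icc 0 (G.length e))
    (h : ∀ τ ∈ Icc u v, dist p (G.edgePoint e τ) = min (a + τ) (b - τ)) {τ τ' : ℝ}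
    (hτ : τ ∈ Icc u v) (hτ' : τ' ∈ Icc u v) (hc : c < dist p (G.edgePoint e τ))
    (hc' : c < dist p (G.edgePoint e τ')) :
    JoinedAbove (fun x => dist p x) c (G.edgePoint e τ) (G.edgePoint e τ') := by
  have hs : uIcc τ τ' ⊆ Icc u v := ordConnected_Icc.uIcc_subset hτ hτ'
  refine ⟨min (dist p (G.edgePoint e τ)) (dist p (G.edgePoint e τ')), lt_min hc hc',
    G.edgePoint e '' uIcc τ τ',
    isPreconnected_uIcc.image _ ((continuousOn_edgePoint e).mono (hs.trans hsub)),
    mem_image_of_mem _ left_mem_uIcc, mem_image_of_mem _ right_mem_uIcc, ?_⟩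
  rintro _ ⟨σ, hσ, rfl⟩
  dsimp only
  rw [h σ (hs hσ), h τ hτ, h τ' hτ']
  rcases mem_uIcc.1 hσ with ⟨h₁, h₂⟩ | ⟨h₁, h₂⟩ <;> simp only [le_min_iff, min_le_iff]
  · exact ⟨.inl (.inl (by linarith)), .inr (.inr (by linarith))⟩
  · exact ⟨.inr (.inl (by linarith)), .inl (.inr (by linarith))⟩

/-- A point exactly at level `c` is neither a node nor `p`, so the distance near it is `min (a + τ)
(b - τ)`. If the two branches cross there, it is a strict local maximum, hence isolated; otherwise
the distance increases strictly to one side. -/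
theorem dist_local_structure (p : G.Point) {c : ℝ} (hc₀ : 0 < c)
    (hc : ∀ v, c ≠ dist p (.node v)) (z : G.Point) (hz : c ≤ dist p z) :
    (∀ᶠ w in 𝓝 z, c ≤ dist p w → w = z) ∨
      ((∃ᶠ w in 𝓝 z, c < dist p w) ∧
        ∃ N ∈ 𝓝 z, ∀ w ∈ N, ∀ w' ∈ N, c < dist p w → c < dist p w' →
          JoinedAbove (fun x => dist p x) c w w') := by
  rcases hz.lt_or_eq with hz | hz
  · obtain ⟨N, hN, hNJ⟩ := eventually_joinedAbove_dist p hz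
    refine .inr ⟨?_, N, hN, fun w hw w' hw' _ _ => (hNJ w hw).symm.trans (hNJ w' hw')⟩
    exact ((continuous_const.dist continuous_id).continuousAt.eventually
      (lt_mem_nhds hz)).frequently
  obtain ⟨e, t, ht, rfl⟩ : ∃ e, ∃ t ∈ Ioo 0 (G.length e), G.edgePoint e t = z := by
    match z with
    | .node v => exact absurd hz (hc v)
    | .inner e t h₀ h₁ => exact ⟨e, t, ⟨h₀, h₁⟩, edgePoint_inner G e t h₀ h₁⟩
  obtain ⟨r, hr, hsub, a, b, hab⟩ :=
    exists_dist_edgePoint_eq_min_nhds p e ht (dist_pos.1 (hz ▸ hc₀))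
  have htI : t ∈ Icc (t - r) (t + r) := ⟨by linarith, by linarith⟩
  have hball := ball_edgePoint_subset e (hsub (left_mem_Icc.2 (by linarith))).1
    (hsub (right_mem_Icc.2 (by linarith))).2
  have hlim : Tendsto (G.edgePoint e) (𝓝 t) (𝓝 (G.edgePoint e t)) :=
    (continuousOn_edgePoint e).continuousAt (Icc_mem_nhds ht.1 ht.2)
  have hJ : ∃ N ∈ 𝓝 (G.edgePoint e t), ∀ w ∈ N, ∀ w' ∈ N, c < dist p w → c < dist p w' →
      JoinedAbove (fun x => dist p x) c w w' := by
    refine ⟨_, Metric.ball_mem_nhds _ hr, fun w hw w' hw' hcw hcw' => ?_⟩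
    obtain ⟨τ, hτ, rfl⟩ := hball hw
    obtain ⟨τ', hτ', rfl⟩ := hball hw'
    exact joinedAbove_dist_edgePoint hsub hab (Ioo_subset_Icc_self hτ) (Ioo_subset_Icc_self hτ')
      hcw hcw'
  rw [hab t htI] at hz
  rcases lt_trichotomy (a + t) (b - t) with h | h | h
  · rw [min_eq_left h.le] at hz
    refine .inr ⟨(hlim.mono_left (nhdsWithin_le_nhds (s := Ioi t))).frequently
      (Eventually.frequently ?_), hJ⟩
    filter_upwards [Ioo_mem_nhdsGT (show t < min (t + r) (b - c) from
      lt_min (by linarith) (by linarith))] with τ hτ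
    have := lt_min_iff.1 hτ.2
    rw [hab τ ⟨by linarith [hτ.1], this.1.le⟩]
    exact lt_min (by linarith [hτ.1]) (by linarith)
  · rw [min_eq_left h.le] at hz
    left
    filter_upwards [Metric.ball_mem_nhds _ hr] with w hw hcw
    obtain ⟨τ, hτ, rfl⟩ := hball hw
    rw [hab τ (Ioo_subset_Icc_self hτ), le_min_iff] at hcw
    rw [show τ = t by linarith]
  · rw [min_eq_right h.le] at hz
    refine .inr ⟨(hlim.mono_left (nhdsWithin_le_nhds (s := Iio t))).frequently
      (Eventually.frequently ?_), hJ⟩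
    filter_upwards [Ioo_mem_nhdsLT (show max (t - r) (c - a) < t from
      max_lt (by linarith) (by linarith))] with τ hτ
    have := max_lt_iff.1 hτ.1
    rw [hab τ ⟨this.1.le, by linarith [hτ.2]⟩]
    exact lt_min (by linarith) (by linarith [hτ.2])

/-- A component of the super-level sets of the distance to `p` dies at `p` or at a node. -/
theorem _root_.IsPersistencePoint.death_eq_zero_or_eq_dist_node {p : G.Point} {b d : ℝ}
    (h : IsPersistencePoint (fun x => dist p x) b d) : d = 0 ∨ ∃ v, d = dist p (.node v) := by
  obtain ⟨hdb, x, y, hx, hy, hmem, hnot⟩ := h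
  by_contra! hd
  rcases lt_or_gt_of_ne hd.1 with hd₀ | hd₀
  · refine (hnot (d / 2) (by linarith)).1 ?_
    have key : ∀ α : ℝ, α < 0 → {z | α ≤ dist p z} = univ := fun α hα =>
      eq_univ_of_forall fun z => hα.le.trans dist_nonneg
    rw [key _ hd₀] at hmem
    rwa [key _ (by linarith)]
  · have hJ := JoinedAbove.of_mem_connectedComponentIn (f := fun x => dist p x)
      (dist_local_structure p hd₀ hd.2) (x := x) (y := y) (hdb.trans_eq hx.symm)
      (hdb.trans_le hy) hmem
    obtain ⟨α, hα, hyα⟩ := hJ.exists_mem_connectedComponentIn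
    exact (hnot α hα).1 hyα

/-- The distance to a node, as a function on an edge. -/
theorem dist_edgePoint_node (e : E) {s : ℝ} (hs : s ∈ Icc 0 (G.length e)) (v : V) :
    dist (G.edgePoint e s) (.node v) = min (dist (G.edgePoint e 0) (.node v) + s)
      (dist (G.edgePoint e (G.length e)) (.node v) + G.length e - s) := by
  rw [dist_edgePoint_eq_min e le_rfl le_rfl hs, sub_zero, add_sub_assoc]
  intro τ hτ
  rw [edgePoint_inner G e τ hτ.1 hτ.2]
  simp

end MetricGraph

/-! ### Continuous selections and piecewise linearity on the line -/

/-- A continuous selection from finitely many 1-Lipschitz functions is 1-Lipschitz. -/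
theorem lipschitzOnWith_one_of_selection {ι : Type*} [Finite ι] {I : Set ℝ} (hI : I.OrdConnected)
    {d : ℝ → ℝ} (hd : ContinuousOn d I) (g : ι → ℝ → ℝ) (hg : ∀ i, LipschitzOnWith 1 (g i) I)
    (h : ∀ s ∈ I, ∃ i, d s = g i s) : LipschitzOnWith 1 d I := by
  have key : ∀ s ∈ I, ∀ t ∈ I, s ≤ t → |d t - d s| ≤ t - s := by
    intro s hs t ht hst
    have hsub : Icc s t ⊆ I := hI.out hs ht
    have hcont : ContinuousOn d (Icc s t) := hd.mono hsub
    have hclosed : IsClosed ({τ | |d τ - d s| ≤ τ - s} ∩ Icc s t) := by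
      have := isClosed_Icc.isClosed_le (f := fun τ => |d τ - d s|) (g := fun τ => τ - s)
        (hcont.sub continuousOn_const).abs (continuousOn_id.sub continuousOn_const)
      convert this using 1
      ext τ
      simp [and_comm]
    refine hclosed.Icc_subset_of_forall_exists_gt (by simp) ?_ (right_mem_Icc.2 hst)
    rintro τ ⟨hτ, hτI⟩ y hy
    have hτI' : τ ∈ Icc s t := Ico_subset_Icc_self hτI
    -- Near `τ`, only functions that agree with `d` at `τ` can be selected, so the Lipschitz bound
    -- extends a little to the right.
    have hev : ∀ᶠ σ in 𝓝[Icc s t] τ, ∀ i, d τ ≠ g i τ → d σ ≠ g i σ := by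
      refine eventually_all.2 fun i => ?_
      by_cases hi : d τ = g i τ
      · exact .of_forall fun σ h => absurd hi h
      · have hc : ContinuousWithinAt (fun σ => d σ - g i σ) (Icc s t) τ :=
          (hcont τ hτI').sub (((hg i).continuousOn.mono hsub) τ hτI')
        filter_upwards [hc.eventually_ne (sub_ne_zero.2 hi)] with σ hσ _
        exact sub_ne_zero.1 hσ
    have hev' : ∀ᶠ σ in 𝓝[>] τ, ∀ i, d τ ≠ g i τ → d σ ≠ g i σ := by
      refine hev.filter_mono ?_
      rw [← nhdsWithin_Ioc_eq_nhdsGT hτI.2]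
      exact nhdsWithin_mono _ (Ioc_subset_Icc_self.trans (Icc_subset_Icc_left hτI.1))
    obtain ⟨σ, hσ, hσy⟩ := (hev'.and (Ioc_mem_nhdsGT (show τ < min y t from
      lt_min hy hτI.2))).exists
    have hσ₁ : σ ≤ y := hσy.2.trans (min_le_left _ _)
    have hσ₂ : σ ≤ t := hσy.2.trans (min_le_right _ _)
    have hσI : σ ∈ I := hsub ⟨hτI.1.trans hσy.1.le, hσ₂⟩
    refine ⟨σ, ?_, hσy.1, hσ₁⟩
    obtain ⟨i, hi⟩ := h σ hσI
    have hi' : d τ = g i τ := by_contra fun hne => hσ i hne hi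
    have hl := (hg i).dist_le_mul σ hσI τ (hsub hτI')
    rw [← hi, ← hi', Real.dist_eq, Real.dist_eq, NNReal.coe_one, one_mul,
      abs_of_pos (sub_pos.2 hσy.1)] at hl
    have := abs_sub_le (d σ) (d τ) (d s)
    simp only [mem_ofPred_eq] at hτ ⊢
    linarith
  refine LipschitzOnWith.of_dist_le_mul fun s hs t ht => ?_
  rw [Real.dist_eq, Real.dist_eq, NNReal.coe_one, one_mul]
  rcases le_total s t with hst | hst
  · rw [abs_sub_comm, abs_sub_comm s t, abs_of_nonneg (sub_nonneg.2 hst)]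
    exact key s hs t ht hst
  · rw [abs_of_nonneg (sub_nonneg.2 hst)]
    exact key t ht s hs hst

/-- Finitely many breakpoints enclosing `I`, between which `g` has unit slope, witness that `g` is
piecewise of unit slope. -/
theorem IsPiecewiseUnitSlope.of_finset {g : ℝ → ℝ} {I : Set ℝ} {N : ℕ} (T : Finset ℝ)
    (hcard : T.card ≤ N) (hI : ∀ s ∈ I, (∃ u ∈ T, u ≤ s) ∧ ∃ u ∈ T, s ≤ u)
    (hg : ∀ u w, u < w → (∀ τ ∈ T, τ ∉ Ioo u w) → ∃ σ c : ℝ, (σ = 1 ∨ σ = -1) ∧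
      ∀ s ∈ I ∩ Icc u w, g s = σ * s + c) : IsPiecewiseUnitSlope g I N := by
  rcases T.eq_empty_or_nonempty with rfl | hT
  · refine ⟨0, Nat.zero_le _, 0, monotone_const, fun s hs => ?_, by simp⟩
    simpa using hI s hs
  obtain ⟨k, hk⟩ : ∃ k, T.card = k + 1 := Nat.exists_eq_succ_of_ne_zero hT.card_pos.ne'
  set f := T.orderEmbOfFin hk with hf
  have hrange : ∀ u ∈ T, ∃ i, f i = u := fun u hu => by
    have : u ∈ Set.range f := by rw [hf, Finset.range_orderEmbOfFin]; exact hu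
    exact this
  -- The `k + 1` sorted breakpoints bound `k` pieces; clamping the index at `k` gives a monotone
  -- sequence on all of `ℕ`.
  refine ⟨k, by omega, fun i => f ⟨min i k, by omega⟩, fun i j hij => ?_, fun s hs => ⟨?_, ?_⟩,
    fun i hi => ?_⟩
  · exact f.monotone (Fin.mk_le_mk.2 (min_le_min_right k hij))
  · obtain ⟨u, hu, hus⟩ := (hI s hs).1
    obtain ⟨j, rfl⟩ := hrange u hu
    exact (f.monotone (Fin.mk_le_of_le_val (by simp))).trans hus
  · obtain ⟨u, hu, hus⟩ := (hI s hs).2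
    obtain ⟨j, rfl⟩ := hrange u hu
    exact hus.trans (f.monotone (Fin.le_def.2 (by simp; omega)))
  · refine hg _ _ (f.strictMono (Fin.mk_lt_mk.2 (by omega))) fun τ hτ hτI => ?_
    obtain ⟨j, rfl⟩ := hrange τ hτ
    have h₁ := Fin.lt_def.1 (f.lt_iff_lt.1 hτI.1)
    have h₂ := Fin.lt_def.1 (f.lt_iff_lt.1 hτI.2)
    simp only at h₁ h₂
    omega

/-- If `I` is covered by finitely many intervals on each of which `g` has unit slope, then the ends
of these intervals cut `I` into pieces. -/
theorem IsPiecewiseUnitSlope.of_cover {ι : Type*} [Fintype ι] {g : ℝ → ℝ} {I : Set ℝ}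
    (hI : I.OrdConnected) (hb : BddBelow I) (hb' : BddAbove I) (hg : ContinuousOn g I)
    (S : ι → Set ℝ) (hSI : ∀ i, S i ⊆ I) (hS : ∀ i, (S i).OrdConnected) (hcov : I ⊆ ⋃ i, S i)
    (hslope : ∀ i, ∃ σ c : ℝ, (σ = 1 ∨ σ = -1) ∧ ∀ s ∈ S i, g s = σ * s + c) :
    IsPiecewiseUnitSlope g I (2 * Fintype.card ι) := by
  classical
  have hlow : ∀ i, ∀ s ∈ S i, sInf (S i) ≤ s := fun i s hs => csInf_le (hb.mono (hSI i)) hs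
  have hupp : ∀ i, ∀ s ∈ S i, s ≤ sSup (S i) := fun i s hs => le_csSup (hb'.mono (hSI i)) hs
  refine .of_finset (Finset.univ.image (fun i => sInf (S i)) ∪ Finset.univ.image
    fun i => sSup (S i)) ?_ (fun s hs => ?_) fun u w huw hT => ?_
  · refine (Finset.card_union_le _ _).trans ?_
    rw [two_mul]
    exact add_le_add Finset.card_image_le Finset.card_image_le
  · obtain ⟨i, hi⟩ := mem_iUnion.1 (hcov hs)
    exact ⟨⟨_, by simp, hlow i s hi⟩, ⟨_, by simp, hupp i s hi⟩⟩
  by_cases hsub : (I ∩ Icc u w).Subsingleton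
  · rcases hsub.eq_empty_or_singleton with h | ⟨a, h⟩
    · exact ⟨1, 0, .inl rfl, by simp [h]⟩
    · exact ⟨1, g a - a, .inl rfl, by simp [h]⟩
  rw [not_subsingleton_iff] at hsub
  obtain ⟨p, hp, q, hq, hpq⟩ := hsub.exists_lt
  -- The covering interval that contains this midpoint has no end inside `(u, w)`, so it contains
  -- all of `(u, w)`.
  have hmem : (p + q) / 2 ∈ I := hI.out hp.1 hq.1 ⟨by linarith, by linarith⟩
  obtain ⟨i, hi⟩ := mem_iUnion.1 (hcov hmem)
  have h₁ : sInf (S i) ≤ u := by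
    by_contra! h
    exact hT (sInf (S i)) (by simp) ⟨h, by linarith [hlow i _ hi, hq.2.2]⟩
  have h₂ : w ≤ sSup (S i) := by
    by_contra! h
    exact hT (sSup (S i)) (by simp) ⟨by linarith [hupp i _ hi, hp.2.1], h⟩
  have hSsub : Ioo u w ⊆ S i := by
    intro s hs
    obtain ⟨a, ha, has⟩ := exists_lt_of_csInf_lt ⟨_, hi⟩ (h₁.trans_lt hs.1)
    obtain ⟨b, hb, hsb⟩ := exists_lt_of_lt_csSup ⟨_, hi⟩ (hs.2.trans_le h₂)
    exact (hS i).out ha hb ⟨has.le, hsb.le⟩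
  obtain ⟨σ, c, hσ, hc⟩ := hslope i
  refine ⟨σ, c, hσ, fun s hs => ?_⟩
  -- The formula is known only on the open gap; continuity of `g` on `I` carries it to the ends.
  have hcl : s ∈ closure (I ∩ Ioo u w) := by
    rcases lt_or_ge s q with hsq | hqs
    · refine closure_mono (s := Ioo s q) (t := I ∩ Ioo u w) (fun r hr =>
        ⟨hI.out hs.1 hq.1 (Ioo_subset_Icc_self hr),
        hs.2.1.trans_lt hr.1, hr.2.trans_le hq.2.2⟩) ?_
      rw [closure_Ioo hsq.ne]
      exact left_mem_Icc.2 hsq.le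
    · have hps := hpq.trans_le hqs
      refine closure_mono (s := Ioo p s) (t := I ∩ Ioo u w) (fun r hr =>
        ⟨hI.out hp.1 hs.1 (Ioo_subset_Icc_self hr),
        hp.2.1.trans_lt hr.1, hr.2.trans_le hs.2.2⟩) ?_
      rw [closure_Ioo hps.ne]
      exact right_mem_Icc.2 hps.le
  have hne : (𝓝[I ∩ Ioo u w] s).NeBot := mem_closure_iff_nhdsWithin_neBot.1 hcl
  have t₁ : Tendsto g (𝓝[I ∩ Ioo u w] s) (𝓝 (g s)) := (hg s hs.1).mono inter_subset_left
  have t₂ : Tendsto (fun s => σ * s + c) (𝓝[I ∩ Ioo u w] s) (𝓝 (σ * s + c)) :=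
    Continuous.continuousWithinAt (by fun_prop)
  refine tendsto_nhds_unique (t₁.congr' ?_) t₂
  filter_upwards [self_mem_nhdsWithin] with r hr using hc r (hSsub hr.2)

/-- A 1-Lipschitz function that meets a line of slope `±1` at two points changes at the maximal rate
between them, so it agrees with the line there. Hence the coincidence sets are order-connected and
`of_cover` applies to two of them per index. -/
theorem LipschitzOnWith.isPiecewiseUnitSlope {ι : Type*} [Fintype ι] {d : ℝ → ℝ} {I : Set ℝ}
    (hI : I.OrdConnected) (hb : BddBelow I) (hb' : BddAbove I) (hd : LipschitzOnWith 1 d I)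
    (a c : ι → ℝ) (h : ∀ s ∈ I, ∃ i, d s = min (a i + s) (c i - s)) :
    IsPiecewiseUnitSlope d I (4 * Fintype.card ι) := by
  have hle : ∀ s ∈ I, ∀ t ∈ I, s ≤ t → |d s - d t| ≤ t - s := fun s hs t ht hst => by
    have := hd.dist_le_mul s hs t ht
    rwa [Real.dist_eq, Real.dist_eq, NNReal.coe_one, one_mul, abs_sub_comm s t,
      abs_of_nonneg (sub_nonneg.2 hst)] at this
  have hcov := IsPiecewiseUnitSlope.of_cover (ι := ι ⊕ ι) hI hb hb' hd.continuousOn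
    (Sum.elim (fun i => {s ∈ I | d s = a i + s}) fun i => {s ∈ I | d s = c i - s}) ?_ ?_ ?_ ?_
  · rw [Fintype.card_sum] at hcov
    convert hcov using 1
    ring
  · rintro (i | i) s hs <;> exact hs.1
  · rintro (i | i)
    · refine ⟨fun s hs t ht r hr => ?_⟩
      have hrI := hI.out hs.1 ht.1 hr
      have h₁ := abs_le.1 (hle s hs.1 r hrI hr.1)
      have h₂ := abs_le.1 (hle r hrI t ht.1 hr.2)
      exact ⟨hrI, by linarith [hs.2, ht.2]⟩
    · refine ⟨fun s hs t ht r hr => ?_⟩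
      have hrI := hI.out hs.1 ht.1 hr
      have h₁ := abs_le.1 (hle s hs.1 r hrI hr.1)
      have h₂ := abs_le.1 (hle r hrI t ht.1 hr.2)
      exact ⟨hrI, by linarith [hs.2, ht.2]⟩
  · intro s hs
    obtain ⟨i, hi⟩ := h s hs
    rcases min_choice (a i + s) (c i - s) with hm | hm <;> rw [hm] at hi
    · exact mem_iUnion.2 ⟨.inl i, hs, hi⟩
    · exact mem_iUnion.2 ⟨.inr i, hs, hi⟩
  · rintro (i | i)
    · exact ⟨1, a i, .inl rfl, fun s hs => by rw [hs.2]; ring⟩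
    · exact ⟨-1, c i, .inr rfl, fun s hs => by rw [hs.2]; ring⟩

/-! ### The dichotomy for death times and the main theorem -/

namespace MetricGraph

/-- While the basepoint moves in the interior of an edge, a persistence point that dies at a node
never starts to die at the basepoint, and vice versa. -/
theorem IsTracking.death_eq_zero_or_forall_eq_dist_node {V E : Type*} [Finite E]
    {G : MetricGraph V E} {e : E} {I : Set ℝ} (hI : I.OrdConnected) (hIe : I ⊆ Icc 0 (G.length e))
    {b d : ℝ → ℝ} (h : G.IsTracking e I b d) :
    (∀ s ∈ I, d s = 0) ∨ ∀ s ∈ I, ∃ v, d s = dist (G.edgePoint e s) (.node v) := by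
  have hd := h.2.1
  have hsel : ∀ s ∈ I, d s = 0 ∨ ∃ v, d s = dist (G.edgePoint e s) (.node v) := fun s hs =>
    (h.2.2 s hs).death_eq_zero_or_eq_dist_node
  by_contra! hcon
  obtain ⟨⟨s₁, hs₁, hd₁⟩, s₂, hs₂, hd₂⟩ := hcon
  have hz₂ : d s₂ = 0 := (hsel s₂ hs₂).resolve_right fun ⟨v, hv⟩ => hd₂ v hv
  have hs₂0 : 0 < s₂ := by
    refine (hIe hs₂).1.lt_of_ne fun h0 => hd₂ (G.src e) ?_
    rw [hz₂, ← h0, edgePoint_zero, dist_self]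
  have hs₂L : s₂ < G.length e := by
    refine (hIe hs₂).2.lt_of_ne fun hL => hd₂ (G.tgt e) ?_
    rw [hz₂, hL, edgePoint_length, dist_self]
  -- Any path to a node must first leave the edge's interior through one of its ends.
  have hlow : ∀ s ∈ I, d s = 0 ∨ min s (G.length e - s) ≤ d s := by
    refine fun s hs => (hsel s hs).imp_right ?_
    rintro ⟨v, hv⟩
    rw [hv, dist_edgePoint_node e (hIe hs)]
    refine min_le_min ?_ ?_
    · linarith [dist_nonneg (x := G.edgePoint e 0) (y := .node v)]
    · linarith [dist_nonneg (x := G.edgePoint e (G.length e)) (y := .node v)]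
  have hnonneg : ∀ s ∈ I, 0 ≤ d s := fun s hs => (hsel s hs).elim (fun h => h.ge)
    fun ⟨v, hv⟩ => hv ▸ dist_nonneg
  have hbet : ∀ s ∈ I, ∀ r ∈ uIcc s s₂, r ≠ s → r ∈ Ioo 0 (G.length e) := by
    intro s hs r hr hrs
    have := hIe hs
    rcases mem_uIcc.1 hr with ⟨h₁, h₂⟩ | ⟨h₁, h₂⟩
    · exact ⟨this.1.trans_lt (h₁.lt_of_ne' hrs), h₂.trans_lt hs₂L⟩
    · exact ⟨hs₂0.trans_le h₁, (h₂.lt_of_ne hrs).trans_le this.2⟩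
  have hivt : ∀ s ∈ I, ∀ η, 0 ≤ η → η ≤ d s → ∃ r ∈ uIcc s s₂, r ∈ I ∧ d r = η := by
    intro s hs η h₀ h₁
    have hsubI := hI.uIcc_subset hs hs₂
    obtain ⟨r, hr, hrη⟩ := intermediate_value_uIcc (hd.mono hsubI)
      (show η ∈ uIcc (d s) (d s₂) from mem_uIcc.2 (.inr ⟨hz₂.trans_le h₀, h₁⟩))
    exact ⟨r, hr, hsubI hr, hrη⟩
  have hpos₁ : 0 < d s₁ := (hnonneg s₁ hs₁).lt_of_ne' hd₁
  -- Since `s₁` may be an end of the edge, move towards `s₂` to an interior parameter where `d` is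
  -- still positive.
  obtain ⟨s, hs, hs0, hds⟩ : ∃ s ∈ I, s ∈ Ioo 0 (G.length e) ∧ 0 < d s := by
    obtain ⟨r, hr, hrI, hrd⟩ := hivt s₁ hs₁ (d s₁ / 2) (by linarith) (by linarith)
    exact ⟨r, hrI, hbet s₁ hs₁ r hr (by rintro rfl; linarith), by linarith⟩
  -- Every parameter between `s` and `s₂` is at least `m` away from both ends of the edge. The
  -- intermediate value theorem gives one where `d` is positive but smaller than `m`, against
  -- `hlow`.
  set m := min (min s s₂) (min (G.length e - s) (G.length e - s₂)) with hm
  have hm₀ : 0 < m := lt_min (lt_min hs0.1 hs₂0) (lt_min (by linarith [hs0.2]) (by linarith))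
  obtain ⟨r, hr, hrI, hrd⟩ := hivt s hs (min m (d s) / 2)
    (by have := lt_min hm₀ hds; linarith)
    (by linarith [min_le_right m (d s)])
  have hη : 0 < min m (d s) := lt_min hm₀ hds
  have hηm : min m (d s) ≤ m := min_le_left _ _
  have hmr : m ≤ min r (G.length e - r) := by
    refine le_min ((min_le_left _ _).trans hr.1) ((min_le_right _ _).trans ?_)
    have : r ≤ max s s₂ := hr.2
    rcases le_max_iff.1 this with h | h
    · exact (min_le_left _ _).trans (by linarith)
    · exact (min_le_right _ _).trans (by linarith)
  rcases hlow r hrI with h | h <;> linarith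

end MetricGraph

theorem mainTheorem9 :
    ∃ C : ℕ, ∀ (V : Type*) (E : Type*) [Fintype V] [Fintype E] (G : MetricGraph V E) (e : E)
      (I : Set ℝ) (_ : I.OrdConnected) (_ : I ⊆ Set.Icc 0 (G.length e)) (b d : ℝ → ℝ),
      G.IsTracking e I b d →
        ((∀ s ∈ I, d s = 0) ∨ IsPiecewiseUnitSlope d I (C * Fintype.card V)) ∧
        LipschitzOnWith 1 d I := by
  refine ⟨4, fun V E _ _ G e I hI hIe b d h => ?_⟩
  rcases h.death_eq_zero_or_forall_eq_dist_node hI hIe with h0 | hsel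
  · refine ⟨.inl h0, fun s hs t ht => by rw [h0 s hs, h0 t ht]; simp⟩
  have hlip : LipschitzOnWith 1 d I := by
    refine lipschitzOnWith_one_of_selection hI h.2.1
      (fun v s => dist (G.edgePoint e s) (.node v)) (fun v => ?_) hsel
    refine LipschitzOnWith.of_dist_le_mul fun s hs t ht => ?_
    rw [NNReal.coe_one, one_mul]
    exact (dist_dist_dist_le_left _ _ _).trans
      (MetricGraph.dist_edgePoint_le e (hIe hs) (hIe ht))
  refine ⟨.inr ?_, hlip⟩
  refine hlip.isPiecewiseUnitSlope hI (bddBelow_Icc.mono hIe) (bddAbove_Icc.mono hIe)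
    (fun v => dist (G.edgePoint e 0) (.node v))
    (fun v => dist (G.edgePoint e (G.length e)) (.node v) + G.length e) fun s hs => ?_
  obtain ⟨v, hv⟩ := hsel s hs
  exact ⟨v, hv.trans (MetricGraph.dist_edgePoint_node e (hIe hs) v)⟩
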